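/- Let $\gamma>0$. A point measure $\phi$ is a locally finite countable sum of Dirac masses at points of a closed subset of $\mathbb{R}^2$. For a point measure $\phi^e$ on $[-1,2]\times(-\infty,0]$ and $x\in[0,1]$ let $\tilde g(x)$ be the minimal $p_0\in\mathbb{R}$ such that there is $p_1\in\mathbb{R}$ with \[ Y\le p_0+p_1(X-x)\quad\text{for all points }(X,Y)\text{ of }\phi^e\text{ with }|x-X|<1, \] and for a point measure $\phi^o$ on $[0,1]\times(-\infty,0]$ with points $(X_i,Y_i)$, $i=1,2,\dots$ (listed with multiplicity), put \[ G(\phi^o,\phi^e,\gamma):=\frac12\int_0^1\tilde g(x)^2\,dx+\frac2\gamma\sum_i Y_i\,\mathbf 1_{\{Y_i\ge\tilde g(X_i)\}} . \] Let $\Phi^o_1,\dots,\Phi^o_5$ be homogeneous Poisson processes on $[0,1]\times(-\infty,0]$ and $\Phi^e$ a homogeneous Poisson process on $\mathbb{R}\times(-\infty,0]$, all of intensity $\gamma$ and all independent. For $l=1,\dots,5$ let \[ \Phi^e_l:=\{(X-(l-1),Y)\mid (X,Y)\in\Phi^e,\ X\in(l-2,l+1]\}, \] and put \[ A_\gamma:=\sum_{l=1}^5\operatorname{Cov}\big(G(\Phi^o_3,\Phi^e_3,\gamma),\,G(\Phi^o_l,\Phi^e_l,\gamma)\big).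 \] Then the random variables $G(\Phi^o_l,\Phi^e_l,\gamma)$, $l=1,\dots,5$, are square integrable, so that these covariances are finite, and \[ A_\gamma=\frac{A_1}{\gamma^4}, \] on whatever probability spaces the processes of intensity $\gamma$ and those of intensity $1$ are realized. -/

import Mathlib

open MeasureTheory ProbabilityTheory Set
open scoped ENNReal NNReal

namespace BoundaryRegression

noncomputable section

/-- `φ` is a (locally finite) point measure on the closed set `E ⊆ ℝ²`: a countable sum of Dirac
masses at points of `E`, multiplicities allowed, with finite mass on compact sets. -/
def IsPointMeasure (E : Set (ℝ × ℝ)) (φ : Measure (ℝ × ℝ)) : Prop :=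
  (∃ (ι : Type) (_ : Countable ι) (p : ι → ℝ × ℝ),
    (∀ i, p i ∈ E) ∧ φ = Measure.sum fun i => Measure.dirac (p i)) ∧
  ∀ K : Set (ℝ × ℝ), IsCompact K → φ K < ∞

/-- `Φ` is a homogeneous Poisson process with intensity `γ` on the closed set `E ⊆ ℝ²`: a random
point measure on `E` such that the number of points in a measurable set `B` with
`|B ∩ E| < ∞` is Poisson distributed with parameter `γ |B ∩ E|`, and the numbers of points in
finitely many pairwise disjoint measurable sets are independent. -/
structure IsPoissonProcess {Ω : Type*} [MeasurableSpace Ω] (μ : Measure Ω) (γ : ℝ)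
    (E : Set (ℝ × ℝ)) (Φ : Ω → Measure (ℝ × ℝ)) : Prop where
  measurable : Measurable Φ
  pointMeasure : ∀ ω, IsPointMeasure E (Φ ω)
  law : ∀ B : Set (ℝ × ℝ), MeasurableSet B → volume (B ∩ E) < ∞ →
    μ.map (fun ω => Φ ω B) =
      (poissonMeasure (γ * (volume (B ∩ E)).toReal).toNNReal).map (fun n : ℕ => (n : ℝ≥0∞))
  indep : ∀ (n : ℕ) (B : Fin n → Set (ℝ × ℝ)), (∀ i, MeasurableSet (B i)) →
    Pairwise (fun i j => Disjoint (B i) (B j)) → iIndepFun (fun i ω => Φ ω (B i)) μ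

/-- The boundary estimator with bandwidth `1` applied to the data set `φ`: the minimal `p₀` such
that, for some slope `p₁`, every data point `(X, Y)` with `|x - X| < 1` satisfies
`Y ≤ p₀ + p₁ (X - x)`. -/
def gTilde (φ : Measure (ℝ × ℝ)) (x : ℝ) : ℝ :=
  sInf {p₀ : ℝ | ∃ p₁ : ℝ, ∀ q : ℝ × ℝ, 0 < φ {q} → |x - q.1| < 1 →
    q.2 ≤ p₀ + p₁ * (q.1 - x)}

open Classical in
/-- The functional `G(φᵒ, φᵉ, γ)`. The integral with respect to the point measure `φᵒ` is the sum
over its points `(X, Y)` of `Y 1_{Y ≥ g̃(X)}`. -/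
def G (φo φe : Measure (ℝ × ℝ)) (γ : ℝ) : ℝ :=
  (1 / 2) * (∫ x in (0 : ℝ)..1, gTilde φe x ^ 2) +
    (2 / γ) * (∫ q, (if gTilde φe q.1 ≤ q.2 then q.2 else 0) ∂φo)

/-- The points `(X - (k - 1), Y)` with `(X, Y)` in `φ` and `X ∈ (k - 2, k + 1]`. -/
def window (k : ℝ) (φ : Measure (ℝ × ℝ)) : Measure (ℝ × ℝ) :=
  (φ.restrict (Ioc (k - 2) (k + 1) ×ˢ (univ : Set ℝ))).map fun q => (q.1 - (k - 1), q.2)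

/-- The Poisson processes which enter the definition of the limiting variance: `Φᵒ₁, …, Φᵒ₅` on
`[0,1] × (-∞,0]` and `Φᵉ` on `ℝ × (-∞,0]`, all with intensity `γ` and all independent.
The index `l : Fin 5` stands for the number `l + 1 ∈ {1, …, 5}`. -/
structure IsPoissonSystem {Ω : Type*} [MeasurableSpace Ω] (μ : Measure Ω) (γ : ℝ)
    (Φo : Fin 5 → Ω → Measure (ℝ × ℝ)) (Φe : Ω → Measure (ℝ × ℝ)) : Prop where
  odd : ∀ l, IsPoissonProcess μ γ (Icc (0 : ℝ) 1 ×ˢ Iic (0 : ℝ)) (Φo l)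
  even : IsPoissonProcess μ γ ((univ : Set ℝ) ×ˢ Iic (0 : ℝ)) Φe
  indep_odd : iIndepFun Φo μ
  indep_odd_even : IndepFun (fun ω l => Φo l ω) Φe μ

/-- The random variable `G(Φᵒ_l, Φᵉ_l, γ)`, where `Φᵉ_l` is the `l`-th window of `Φᵉ`. -/
def GVariable {Ω : Type*} (γ : ℝ) (Φo : Fin 5 → Ω → Measure (ℝ × ℝ))
    (Φe : Ω → Measure (ℝ × ℝ)) (l : Fin 5) (ω : Ω) : ℝ :=
  G (Φo l ω) (window ((l : ℕ) + 1 : ℝ) (Φe ω)) γ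

/-- The constant `A_γ = ∑_{l=1}^5 Cov(G(Φᵒ₃, Φᵉ₃, γ), G(Φᵒ_l, Φᵉ_l, γ))`, computed from the given
processes. -/
def varianceConstant {Ω : Type*} [MeasurableSpace Ω] (μ : Measure Ω) (γ : ℝ)
    (Φo : Fin 5 → Ω → Measure (ℝ × ℝ)) (Φe : Ω → Measure (ℝ × ℝ)) : ℝ :=
  ∑ l : Fin 5, cov[GVariable γ Φo Φe 2, GVariable γ Φo Φe l; μ]

end

end BoundaryRegression

/-! The map $(X,Y)\mapsto(X,\gamma Y)$ turns intensity $\gamma$ into intensity $1$ and multiplies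
$\tilde g$ by $\gamma$. Hence `G_scaled`: $G$ at $\gamma$ is $\gamma^{-2}$ times $G$ at $1$ of the
scaled data, and each covariance picks up $\gamma^{-4}$. Two points remain.

The covariances must not depend on the realization. Counts on disjoint sets are independent Poisson
variables, which fixes all finite-dimensional laws and so the law of the process
(`IsPoissonProcess.map_eq`); independence then fixes the joint law. To transport covariances, $G$
must be a measurable function of the processes, which is seen by using only lines with rational
parameters (`toReal_gInf`) and by integrating through an s-finite kernel (`idKernel`).

The variables must be square integrable at intensity $1$. If $\Phi^e$ hits four boxes of depth $n$,
then $-n\le\tilde g\le 0$ on $[0,1]$ and $|G|^2\le n^4(1+2N_n)^2$, where $N_n$ counts the points of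
$\Phi^o$ down to depth $n$. Some box is missed with probability at most $4e^{-n/2}$, independently
of $N_n$, while the second moment of $1+2N_n$ is at most $256e^{17n/64}$; since $17/64<1/2$, the sum
over $n$ converges. -/

namespace BoundaryRegression

noncomputable section

/-! ### Locally finite measures as values of an s-finite kernel -/

/-- The annulus `{q | m ≤ ‖q‖ < m + 1}`. -/
def annulus (m : ℕ) : Set (ℝ × ℝ) := {q | ⌊‖q‖⌋₊ = m}

lemma measurableSet_annulus (m : ℕ) : MeasurableSet (annulus m) :=
  measurableSet_eq_fun (Nat.measurable_floor.comp measurable_norm) measurable_const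

lemma iUnion_annulus : ⋃ m, annulus m = univ :=
  eq_univ_of_forall fun _ => mem_iUnion.2 ⟨_, rfl⟩

lemma pairwise_disjoint_annulus : Pairwise (Function.onFun Disjoint annulus) := fun _ _ h =>
  Set.disjoint_left.2 fun _ h1 h2 => h (h1.symm.trans h2)

lemma annulus_subset (m : ℕ) : annulus m ⊆ Metric.closedBall 0 (m + 1) := by
  rintro q rfl
  simpa using (Nat.lt_floor_add_one ‖q‖).le

/-- `φ` has finite mass on each annulus. -/
def AnnulusFinite (φ : Measure (ℝ × ℝ)) : Prop := ∀ m, φ (annulus m) < ∞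

lemma IsPointMeasure.annulusFinite {E : Set (ℝ × ℝ)} {φ : Measure (ℝ × ℝ)}
    (h : IsPointMeasure E φ) : AnnulusFinite φ := fun m =>
  (measure_mono (annulus_subset m)).trans_lt (h.2 _ (isCompact_closedBall _ _))

lemma measurable_measure_restrict {α : Type*} [MeasurableSpace α] {A : Set α}
    (hA : MeasurableSet A) : Measurable fun φ : Measure α => φ.restrict A := by
  refine Measure.measurable_of_measurable_coe _ fun B hB => ?_
  simp_rw [Measure.restrict_apply hB]
  exact Measure.measurable_coe (hB.inter hA)

/-- The kernel which restricts `φ` to the `m`-th annulus if the mass there is in `[n, n + 1)`. -/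
def annulusKernel (m n : ℕ) : Kernel (Measure (ℝ × ℝ)) (ℝ × ℝ) where
  toFun φ := open Classical in
    if φ (annulus m) < ∞ ∧ ⌊(φ (annulus m)).toReal⌋₊ = n then φ.restrict (annulus m) else 0
  measurable' := by
    classical
    have h := Measure.measurable_coe (measurableSet_annulus m)
    refine Measurable.ite ?_ (measurable_measure_restrict (measurableSet_annulus m))
      measurable_const
    exact (measurableSet_lt h measurable_const).inter
      (measurableSet_eq_fun (Nat.measurable_floor.comp h.ennreal_toReal) measurable_const)

lemma annulusKernel_apply (m n : ℕ) (φ : Measure (ℝ × ℝ)) [Decidable (φ (annulus m) < ∞ ∧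
    ⌊(φ (annulus m)).toReal⌋₊ = n)] : annulusKernel m n φ =
      if φ (annulus m) < ∞ ∧ ⌊(φ (annulus m)).toReal⌋₊ = n then φ.restrict (annulus m) else 0 := by
  simp only [annulusKernel, Kernel.coe_mk]
  congr

/-- Sorting by the integer part of the mass gives the bound $n+1$ uniformly in `φ`; the mass of an
annulus alone has no such bound. -/
instance (m n : ℕ) : IsFiniteKernel (annulusKernel m n) := by
  classical
  refine ⟨n + 1, by finiteness, fun φ => ?_⟩
  rw [annulusKernel_apply]
  split_ifs with h
  · rw [Measure.restrict_apply_univ, ← ENNReal.ofReal_toReal h.1.ne]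
    have := (Nat.lt_floor_add_one (φ (annulus m)).toReal).le
    rw [h.2] at this
    refine (ENNReal.ofReal_le_ofReal this).trans_eq ?_
    rw [ENNReal.ofReal_add (by positivity) zero_le_one]
    simp
  · simp

/-- An s-finite kernel which is the identity on locally finite measures. -/
def idKernel : Kernel (Measure (ℝ × ℝ)) (ℝ × ℝ) :=
  Kernel.sum fun m => Kernel.sum fun n => annulusKernel m n

instance : IsSFiniteKernel idKernel := by
  unfold idKernel
  infer_instance

/-- On each annulus only $n=\lfloor\varphi(\text{annulus})\rfloor$ contributes, and the annuli
partition the plane. -/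
lemma idKernel_apply {φ : Measure (ℝ × ℝ)} (h : AnnulusFinite φ) : idKernel φ = φ := by
  classical
  have h1 : ∀ m, Measure.sum (fun n => annulusKernel m n φ) = φ.restrict (annulus m) := by
    intro m
    ext B hB
    rw [Measure.sum_apply _ hB, tsum_eq_single ⌊(φ (annulus m)).toReal⌋₊]
    · rw [annulusKernel_apply, if_pos ⟨h m, rfl⟩]
    · intro n hn
      rw [annulusKernel_apply, if_neg fun h => hn h.2.symm]
      simp
  rw [idKernel, Kernel.sum_apply]
  simp_rw [Kernel.sum_apply, h1]
  rw [← Measure.restrict_iUnion pairwise_disjoint_annulus measurableSet_annulus, iUnion_annulus,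
    Measure.restrict_univ]

/-! ### Atoms and windows of point measures -/

/-- A set of positive mass contains an atom. -/
def Atomic (φ : Measure (ℝ × ℝ)) : Prop :=
  ∀ B, MeasurableSet B → (∀ q ∈ B, φ {q} = 0) → φ B = 0

lemma IsPointMeasure.atomic {E : Set (ℝ × ℝ)} {φ : Measure (ℝ × ℝ)}
    (h : IsPointMeasure E φ) : Atomic φ := by
  obtain ⟨⟨ι, _, p, -, rfl⟩, -⟩ := h
  intro B hB h
  rw [Measure.sum_apply _ hB, ENNReal.tsum_eq_zero]
  intro i
  rw [Measure.dirac_apply' _ hB, Set.indicator_apply_eq_zero]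
  intro hi
  have := h _ hi
  rw [Measure.sum_apply _ (measurableSet_singleton _), ENNReal.tsum_eq_zero] at this
  simpa using this i

lemma IsPointMeasure.apply_compl {E : Set (ℝ × ℝ)} {φ : Measure (ℝ × ℝ)}
    (h : IsPointMeasure E φ) (hE : MeasurableSet E) : φ Eᶜ = 0 := by
  obtain ⟨⟨ι, _, p, hp, rfl⟩, -⟩ := h
  rw [Measure.sum_apply _ hE.compl, ENNReal.tsum_eq_zero]
  intro i
  rw [Measure.dirac_apply' _ hE.compl]
  simp [hp i]

lemma measurable_shift (k : ℝ) : Measurable fun q : ℝ × ℝ => (q.1 - (k - 1), q.2) := by fun_prop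

lemma window_apply (k : ℝ) (φ : Measure (ℝ × ℝ)) {B : Set (ℝ × ℝ)} (hB : MeasurableSet B) :
    window k φ B = φ ((fun q => (q.1 - (k - 1), q.2)) ⁻¹' B ∩
      Ioc (k - 2) (k + 1) ×ˢ (univ : Set ℝ)) := by
  rw [window, Measure.map_apply (measurable_shift k) hB,
    Measure.restrict_apply (measurable_shift k hB)]

lemma measurable_window (k : ℝ) : Measurable (window k) :=
  (Measure.measurable_map _ (measurable_shift k)).comp
    (measurable_measure_restrict (measurableSet_Ioc.prod MeasurableSet.univ))

lemma Atomic.window {φ : Measure (ℝ × ℝ)} (h : Atomic φ) (k : ℝ) : Atomic (window k φ) := by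
  intro B hB h1
  rw [window_apply k φ hB]
  refine h _ ((measurable_shift k hB).inter (measurableSet_Ioc.prod MeasurableSet.univ)) ?_
  intro q hq
  have := h1 _ hq.1
  rw [window_apply k φ (measurableSet_singleton _)] at this
  exact measure_mono_null (by simpa using hq.2) this

lemma IsPointMeasure.annulusFinite_window {E : Set (ℝ × ℝ)} {φ : Measure (ℝ × ℝ)}
    (h : IsPointMeasure E φ) (k : ℝ) : AnnulusFinite (window k φ) := by
  intro m
  rw [window_apply k φ (measurableSet_annulus m)]
  refine (measure_mono ?_).trans_lt
    (h.2 ((fun q : ℝ × ℝ => (q.1 + (k - 1), q.2)) '' Metric.closedBall 0 (m + 1))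
      ((isCompact_closedBall _ _).image (by fun_prop)))
  rintro q ⟨hq, -⟩
  exact ⟨_, annulus_subset m hq, by simp⟩

/-! ### Measurable versions of `gTilde` and `G` -/

/-- The points that violate the constraint of the line with value `p.1` and slope `p.2` at `x`. -/
def violators (x : ℝ) (p : ℝ × ℝ) : Set (ℝ × ℝ) :=
  {q | |x - q.1| < 1 ∧ p.1 + p.2 * (q.1 - x) < q.2}

lemma measurableSet_violators_prod (p : ℝ × ℝ) :
    MeasurableSet {r : ℝ × (ℝ × ℝ) | r.2 ∈ violators r.1 p} := by
  have h1 : Measurable fun r : ℝ × (ℝ × ℝ) => |r.1 - r.2.1| := by fun_prop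
  have h2 : Measurable fun r : ℝ × (ℝ × ℝ) => p.1 + p.2 * (r.2.1 - r.1) := by fun_prop
  have h3 : Measurable fun r : ℝ × (ℝ × ℝ) => r.2.2 := by fun_prop
  exact (measurableSet_lt h1 measurable_const).inter (measurableSet_lt h2 h3)

lemma measurableSet_violators (x : ℝ) (p : ℝ × ℝ) : MeasurableSet (violators x p) :=
  measurable_prodMk_left (x := x) (measurableSet_violators_prod p)

/-- Turns a condition on uncountably many possible atoms into one on the mass of a single set, which
depends measurably on `φ`. -/
lemma Atomic.violators_eq_zero_iff {φ : Measure (ℝ × ℝ)} (h : Atomic φ) (x : ℝ) (p : ℝ × ℝ) :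
    φ (violators x p) = 0 ↔
      ∀ q : ℝ × ℝ, 0 < φ {q} → |x - q.1| < 1 → q.2 ≤ p.1 + p.2 * (q.1 - x) := by
  constructor
  · intro h0 q hq hx
    by_contra! hlt
    exact hq.ne' (measure_mono_null (singleton_subset_iff.2 (show q ∈ violators x p from ⟨hx, hlt⟩)) h0)
  · intro h1
    refine h _ (measurableSet_violators x p) fun q hq => ?_
    by_contra h0
    exact (h1 q (pos_iff_ne_zero.2 h0) hq.1).not_gt hq.2

open Classical in
/-- A measurable version of `gTilde`, as an infimum over lines with rational parameters. -/
def gInf (φ : Measure (ℝ × ℝ)) (x : ℝ) : EReal :=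
  ⨅ p : ℚ × ℚ, if idKernel φ (violators x (p.1, p.2)) = 0 then ((p.1 : ℝ) : EReal) else ⊤

lemma measurable_gInf : Measurable fun r : Measure (ℝ × ℝ) × ℝ => gInf r.1 r.2 := by
  classical
  refine Measurable.iInf fun p => Measurable.ite ?_ measurable_const measurable_const
  refine measurableSet_eq_fun ?_ measurable_const
  have hS : MeasurableSet {s : (Measure (ℝ × ℝ) × ℝ) × (ℝ × ℝ) |
      s.2 ∈ violators s.1.2 ((p.1 : ℝ), (p.2 : ℝ))} :=
    (measurable_snd.comp measurable_fst).prodMk measurable_snd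
      (measurableSet_violators_prod ((p.1 : ℝ), (p.2 : ℝ)))
  have h := Kernel.measurable_kernel_prodMk_left
    (κ := idKernel.comap (Prod.fst : Measure (ℝ × ℝ) × ℝ → _) measurable_fst) hS
  simpa only [Kernel.comap_apply] using! h

/-- The default values agree: for an empty `S` and for one unbounded below, both sides are $0$. -/
lemma toReal_sInf_image (S : Set ℝ) : (sInf ((↑) '' S : Set EReal)).toReal = sInf S := by
  rcases S.eq_empty_or_nonempty with rfl | hS
  · simp
  by_cases hb : BddBelow S
  · have : sInf ((↑) '' S : Set EReal) = ((sInf S : ℝ) : EReal) := by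
      refine IsGLB.sInf_eq ⟨?_, ?_⟩
      · rintro _ ⟨s, hs, rfl⟩
        exact EReal.coe_le_coe_iff.2 (csInf_le hb hs)
      · intro b hb'
        obtain ⟨s, hs⟩ := hS
        induction b with
        | bot => exact bot_le
        | top => exact absurd (hb' ⟨s, hs, rfl⟩) (by simp)
        | coe b =>
          exact EReal.coe_le_coe_iff.2 (le_csInf ⟨s, hs⟩ fun t ht =>
            EReal.coe_le_coe_iff.1 (hb' ⟨t, ht, rfl⟩))
    rw [this, EReal.toReal_coe]
  · have : sInf ((↑) '' S : Set EReal) = ⊥ := by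
      refine (EReal.eq_bot_iff_forall_lt _).2 fun y => ?_
      rw [not_bddBelow_iff] at hb
      obtain ⟨s, hs, hlt⟩ := hb y
      exact (sInf_le (mem_image_of_mem _ hs)).trans_lt (EReal.coe_lt_coe_iff.2 hlt)
    rw [this, EReal.toReal_bot, Real.sInf_of_not_bddBelow hb]

lemma toReal_gInf {φ : Measure (ℝ × ℝ)} (h : Atomic φ) (hf : AnnulusFinite φ) (x : ℝ) :
    (gInf φ x).toReal = gTilde φ x := by
  classical
  rw [gTilde, ← toReal_sInf_image, gInf, idKernel_apply hf]
  congr 1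
  apply le_antisymm
  · refine le_sInf ?_
    rintro _ ⟨s, ⟨t, ht⟩, rfl⟩
    refine EReal.le_of_forall_lt_iff_le.1 fun z hz => ?_
    obtain ⟨a, ha1, ha2⟩ := exists_rat_btwn (EReal.coe_lt_coe_iff.1 hz)
    -- As $0<b-t<a-s$ and $|X-x|<1$, the rational line $(a,b)$ lies above the line $(s,t)$ on the
    -- whole window.
    obtain ⟨b, hb1, hb2⟩ := exists_rat_btwn (show t < t + (a - s) by linarith)
    refine (iInf_le _ (a, b)).trans ?_
    rw [if_pos]
    · exact EReal.coe_le_coe_iff.2 ha2.le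
    · refine (h.violators_eq_zero_iff _ _).2 fun q hq hx => (ht q hq hx).trans ?_
      rw [abs_lt] at hx
      simp only
      nlinarith
  · refine le_iInf fun p => ?_
    split_ifs with h0
    · exact sInf_le (mem_image_of_mem _ ⟨p.2, (h.violators_eq_zero_iff _ _).1 h0⟩)
    · exact le_top

open Classical in
/-- A measurable version of `G`. -/
def GMeas (φo φe : Measure (ℝ × ℝ)) (γ : ℝ) : ℝ :=
  (1 / 2) * (∫ x in (0 : ℝ)..1, (gInf φe x).toReal ^ 2) +
    (2 / γ) * (∫ q, (if (gInf φe q.1).toReal ≤ q.2 then q.2 else 0) ∂(idKernel φo))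

lemma measurable_integral_idKernel {β : Type*} [MeasurableSpace β]
    {f : (Measure (ℝ × ℝ) × β) × (ℝ × ℝ) → ℝ} (hf : Measurable f) :
    Measurable fun r : Measure (ℝ × ℝ) × β => ∫ q, f (r, q) ∂(idKernel r.1) :=
  (StronglyMeasurable.integral_kernel_prod_right'
    (κ := idKernel.comap (Prod.fst : Measure (ℝ × ℝ) × β → _) measurable_fst)
    hf.stronglyMeasurable).measurable

lemma measurable_toReal_gInf_comp {β : Type*} [MeasurableSpace β] {φ : β → Measure (ℝ × ℝ)}
    {x : β → ℝ} (hφ : Measurable φ) (hx : Measurable x) :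
    Measurable fun b => (gInf (φ b) (x b)).toReal :=
  (measurable_gInf.comp (hφ.prodMk hx)).ereal_toReal

lemma measurable_GMeas (γ : ℝ) :
    Measurable fun r : Measure (ℝ × ℝ) × Measure (ℝ × ℝ) => GMeas r.1 r.2 γ := by
  classical
  refine Measurable.add (Measurable.const_mul ?_ _) (Measurable.const_mul ?_ _)
  · simp_rw [intervalIntegral.integral_of_le zero_le_one]
    exact (StronglyMeasurable.integral_prod_right' (ν := volume.restrict (Ioc (0 : ℝ) 1))
      ((measurable_toReal_gInf_comp (measurable_snd.comp measurable_fst)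
        measurable_snd).pow_const 2).stronglyMeasurable).measurable
  · have h3 : Measurable fun s : (Measure (ℝ × ℝ) × Measure (ℝ × ℝ)) × (ℝ × ℝ) => s.2.2 :=
      measurable_snd.comp measurable_snd
    exact measurable_integral_idKernel (Measurable.ite (measurableSet_le
      (measurable_toReal_gInf_comp (measurable_snd.comp measurable_fst)
        (measurable_fst.comp measurable_snd)) h3) h3 measurable_const)

lemma GMeas_eq {φo φe : Measure (ℝ × ℝ)} (hfo : AnnulusFinite φo) (h : Atomic φe)
    (hf : AnnulusFinite φe) (γ : ℝ) : GMeas φo φe γ = G φo φe γ := by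
  simp_rw [GMeas, G, toReal_gInf h hf, idKernel_apply hfo]

/-! ### Scaling of the second coordinate -/

section

/-- The homeomorphism `(X, Y) ↦ (X, γ Y)`. -/
def vscale (γ : ℝ) (hγ : γ ≠ 0) : ℝ × ℝ ≃ₜ ℝ × ℝ :=
  (Homeomorph.refl ℝ).prodCongr (Homeomorph.mulLeft₀ γ hγ)

@[simp] lemma vscale_apply (γ : ℝ) (hγ : γ ≠ 0) (q : ℝ × ℝ) :
    vscale γ hγ q = (q.1, γ * q.2) := rfl

variable {γ : ℝ} (hγ : 0 < γ)

lemma volume_vscale_preimage (B : Set (ℝ × ℝ)) :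
    volume (vscale γ hγ.ne' ⁻¹' B) = ENNReal.ofReal γ⁻¹ * volume B := by
  have h : (volume : Measure (ℝ × ℝ)).map (vscale γ hγ.ne').toMeasurableEquiv =
      ENNReal.ofReal γ⁻¹ • volume := by
    have h1 : Measure.map (γ * ·) (volume : Measure ℝ) = ENNReal.ofReal γ⁻¹ • volume := by
      rw [Real.map_volume_mul_left hγ.ne', abs_of_pos (inv_pos.2 hγ)]
    have h2 := Measure.map_prod_map (volume : Measure ℝ) (volume : Measure ℝ) measurable_id
      (measurable_const_mul γ)
    rw [h1, Measure.map_id, Measure.prod_smul_right] at h2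
    exact h2.symm
  have := congrArg (fun m => m B) h
  rw [MeasurableEquiv.map_apply] at this
  simpa using! this

lemma vscale_preimage_inter {E : Set (ℝ × ℝ)} (hE : vscale γ hγ.ne' ⁻¹' E = E)
    (B : Set (ℝ × ℝ)) :
    vscale γ hγ.ne' ⁻¹' B ∩ E = vscale γ hγ.ne' ⁻¹' (B ∩ E) := by
  rw [preimage_inter, hE]

lemma vscale_preimage_prod_Iic (s : Set ℝ) :
    vscale γ hγ.ne' ⁻¹' (s ×ˢ Iic (0 : ℝ)) = s ×ˢ Iic (0 : ℝ) := by
  ext q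
  simp [mul_nonpos_iff, hγ.le, hγ.not_ge]

lemma measurable_vscale : Measurable (vscale γ hγ.ne') := (vscale γ hγ.ne').measurable

/-- The image of a measure under `(X, Y) ↦ (X, γ Y)`. -/
def scaled (φ : Measure (ℝ × ℝ)) : Measure (ℝ × ℝ) := φ.map (vscale γ hγ.ne')

lemma scaled_apply (φ : Measure (ℝ × ℝ)) (B : Set (ℝ × ℝ)) :
    scaled hγ φ B = φ (vscale γ hγ.ne' ⁻¹' B) :=
  (vscale γ hγ.ne').toMeasurableEquiv.map_apply B

lemma measurable_scaled : Measurable (scaled hγ) :=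
  Measure.measurable_map _ (measurable_vscale hγ)

lemma IsPointMeasure.scaled {E : Set (ℝ × ℝ)} (hE : vscale γ hγ.ne' ⁻¹' E = E)
    {φ : Measure (ℝ × ℝ)} (h : IsPointMeasure E φ) : IsPointMeasure E (scaled hγ φ) := by
  refine ⟨?_, fun K hK => ?_⟩
  · obtain ⟨⟨ι, hι, p, hp, rfl⟩, -⟩ := h
    refine ⟨ι, hι, fun i => vscale γ hγ.ne' (p i), fun i => ?_, ?_⟩
    · have := hp i
      rwa [← hE] at this
    · rw [BoundaryRegression.scaled, Measure.map_sum (measurable_vscale hγ).aemeasurable]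
      simp_rw [Measure.map_dirac' (measurable_vscale hγ)]
  · rw [scaled_apply]
    exact h.2 _ ((vscale γ hγ.ne').isCompact_preimage.2 hK)

/-- Preimages have $\gamma^{-1}$ times the area, which cancels the intensity; invariance of `E` lets
this be applied to $B\cap E$. -/
lemma IsPoissonProcess.scaled {Ω : Type*} [MeasurableSpace Ω] {μ : Measure Ω}
    {E : Set (ℝ × ℝ)} (hE : vscale γ hγ.ne' ⁻¹' E = E) {Φ : Ω → Measure (ℝ × ℝ)}
    (h : IsPoissonProcess μ γ E Φ) : IsPoissonProcess μ 1 E fun ω => scaled hγ (Φ ω) where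
  measurable := (measurable_scaled hγ).comp h.measurable
  pointMeasure ω := (h.pointMeasure ω).scaled hγ hE
  law B hB hfin := by
    have h1 := volume_vscale_preimage hγ (B ∩ E)
    have h2 := h.law _ (measurable_vscale hγ hB) (by
      rw [vscale_preimage_inter hγ hE, h1]
      exact ENNReal.mul_lt_top ENNReal.ofReal_lt_top hfin)
    simp_rw [scaled_apply]
    rw [h2, vscale_preimage_inter hγ hE, h1, ENNReal.toReal_mul,
      ENNReal.toReal_ofReal (inv_nonneg.2 hγ.le), mul_inv_cancel_left₀ hγ.ne', one_mul]
  indep n B hB hd := by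
    simp_rw [scaled_apply]
    exact h.indep n _ (fun i => measurable_vscale hγ (hB i)) fun i j hij =>
      (hd hij).preimage _

lemma IsPoissonSystem.scaled {Ω : Type*} [MeasurableSpace Ω] {μ : Measure Ω}
    {Φo : Fin 5 → Ω → Measure (ℝ × ℝ)} {Φe : Ω → Measure (ℝ × ℝ)}
    (h : IsPoissonSystem μ γ Φo Φe) :
    IsPoissonSystem μ 1 (fun l ω => scaled hγ (Φo l ω)) fun ω => scaled hγ (Φe ω) where
  odd l := (h.odd l).scaled hγ (vscale_preimage_prod_Iic hγ _)
  even := h.even.scaled hγ (vscale_preimage_prod_Iic hγ _)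
  indep_odd := h.indep_odd.comp (fun _ => BoundaryRegression.scaled hγ)
    fun _ => measurable_scaled hγ
  indep_odd_even := h.indep_odd_even.comp
    (φ := fun (f : Fin 5 → Measure (ℝ × ℝ)) l => BoundaryRegression.scaled hγ (f l))
    (measurable_pi_lambda _ fun l => (measurable_scaled hγ).comp (measurable_pi_apply l))
    (measurable_scaled hγ)

lemma window_scaled (k : ℝ) (φ : Measure (ℝ × ℝ)) :
    window k (scaled hγ φ) = scaled hγ (window k φ) := by
  ext B hB
  rw [window_apply k _ hB, scaled_apply, scaled_apply, window_apply k _ (measurable_vscale hγ hB)]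
  rfl

/-- Scaling both parameters of a line by $\gamma$ matches the admissible sets, and the real infimum
commutes with a nonnegative factor even in its degenerate cases. -/
lemma gTilde_scaled (φ : Measure (ℝ × ℝ)) (x : ℝ) :
    gTilde (scaled hγ φ) x = γ * gTilde φ x := by
  rw [gTilde, gTilde, ← smul_eq_mul, ← Real.sInf_smul_of_nonneg hγ.le]
  congr 1
  ext p₀
  have hs : ∀ q : ℝ × ℝ, scaled hγ φ {q} = φ {(q.1, γ⁻¹ * q.2)} := by
    intro q
    rw [scaled_apply]
    congr 1
    ext r
    simp only [mem_preimage, vscale_apply, mem_singleton_iff, Prod.ext_iff,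
      eq_inv_mul_iff_mul_eq₀ hγ.ne']
  rw [mem_smul_set_iff_inv_smul_mem₀ hγ.ne']
  simp only [mem_ofPred_eq, hs, smul_eq_mul]
  constructor
  · rintro ⟨p₁, h⟩
    refine ⟨γ⁻¹ * p₁, fun q hq hx => ?_⟩
    have := h (q.1, γ * q.2) (by simpa [hγ.ne'] using hq) hx
    rw [mul_assoc, ← mul_add, le_inv_mul_iff₀ hγ]
    exact this
  · rintro ⟨p₁, h⟩
    refine ⟨γ * p₁, fun q hq hx => ?_⟩
    have := h _ hq hx
    rw [inv_mul_le_iff₀ hγ] at this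
    refine this.trans_eq ?_
    simp only
    field_simp

/-- The squared term gains $\gamma^2$. The point sum gains only $\gamma$, and the prefactor
$2/\gamma$ supplies the other power. -/
lemma G_scaled (φo φe : Measure (ℝ × ℝ)) :
    G φo φe γ = (γ ^ 2)⁻¹ * G (scaled hγ φo) (scaled hγ φe) 1 := by
  classical
  have h1 : (∫ q, (if gTilde (scaled hγ φe) q.1 ≤ q.2 then q.2 else 0) ∂(scaled hγ φo)) =
      γ * ∫ q, (if gTilde φe q.1 ≤ q.2 then q.2 else 0) ∂φo := by
    -- Along a measurable embedding the change of variables needs no measurability of the integrand.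
    rw [scaled, (vscale γ hγ.ne').measurableEmbedding.integral_map, ← integral_const_mul]
    congr 1
    ext q
    simp only [vscale_apply, gTilde_scaled, mul_le_mul_iff_right₀ hγ, mul_ite, mul_zero]
  rw [G, G, h1]
  simp_rw [gTilde_scaled, mul_pow, intervalIntegral.integral_const_mul]
  field_simp

lemma GVariable_scaled {Ω : Type*} (Φo : Fin 5 → Ω → Measure (ℝ × ℝ))
    (Φe : Ω → Measure (ℝ × ℝ)) (l : Fin 5) :
    GVariable γ Φo Φe l = fun ω => (γ ^ 2)⁻¹ *
      GVariable 1 (fun l ω => scaled hγ (Φo l ω)) (fun ω => scaled hγ (Φe ω)) l ω := by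
  ext ω
  rw [GVariable, G_scaled hγ, GVariable, window_scaled]

end

/-! ### Uniqueness of the law of the Poisson processes -/

section

/-- The masses that a measure gives to the sets of finite volume. -/
def masses (φ : Measure (ℝ × ℝ))
    (B : {B : Set (ℝ × ℝ) // MeasurableSet B ∧ volume B < ∞}) : ℝ≥0∞ := φ B.1

lemma measurable_masses : Measurable masses :=
  measurable_pi_lambda _ fun B => Measure.measurable_coe B.2.1

lemma volume_annulus_lt_top (m : ℕ) : volume (annulus m) < ∞ :=
  (measure_mono (annulus_subset m)).trans_lt measure_closedBall_lt_top

/-- Any measurable set is cut by the annuli into countably many pieces of finite volume. -/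
lemma measurable_of_measurable_masses {β : Type*} [MeasurableSpace β]
    {Θ : β → Measure (ℝ × ℝ)} (h : Measurable fun b => masses (Θ b)) : Measurable Θ := by
  refine Measure.measurable_of_measurable_coe _ fun s hs => ?_
  have h1 : ∀ φ : Measure (ℝ × ℝ), φ s = ∑' m, φ (s ∩ annulus m) := by
    intro φ
    rw [← measure_iUnion (fun i j hij => (pairwise_disjoint_annulus hij).mono
      inter_subset_right inter_subset_right) (fun m => hs.inter (measurableSet_annulus m)),
      ← inter_iUnion, iUnion_annulus, inter_univ]
  simp only [h1]
  refine Measurable.tsum fun m => ?_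
  exact (measurable_pi_apply (X := fun _ => ℝ≥0∞)
    (⟨s ∩ annulus m, hs.inter (measurableSet_annulus m),
      (measure_mono inter_subset_right).trans_lt (volume_annulus_lt_top m)⟩ :
      {B : Set (ℝ × ℝ) // MeasurableSet B ∧ volume B < ∞})).comp h

lemma le_comap_masses :
    (inferInstance : MeasurableSpace (Measure (ℝ × ℝ))) ≤
      MeasurableSpace.comap masses inferInstance := by
  intro s hs
  exact @measurable_of_measurable_masses _ (MeasurableSpace.comap masses inferInstance) id
    (comap_measurable masses) s hs

lemma measure_ext_of_map_masses {P Q : Measure (Measure (ℝ × ℝ))}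
    (h : P.map masses = Q.map masses) : P = Q := by
  ext s hs
  obtain ⟨t, ht, rfl⟩ := le_comap_masses s hs
  rw [← Measure.map_apply measurable_masses ht, h, Measure.map_apply measurable_masses ht]

variable {ι : Type*}

/-- The points of `⋃ i, B i` which lie in `B i` exactly for `i ∈ s`. -/
def cell (B : ι → Set (ℝ × ℝ)) (s : Finset ι) : Set (ℝ × ℝ) :=
  (⋃ i, B i) ∩ ⋂ i, {q | q ∈ B i ↔ i ∈ s}

lemma pairwise_disjoint_cell (B : ι → Set (ℝ × ℝ)) :
    Pairwise (Function.onFun Disjoint (cell B)) := by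
  refine fun s t hst => Set.disjoint_left.2 fun q hs ht => hst ?_
  ext i
  exact (mem_iInter.1 hs.2 i).symm.trans (mem_iInter.1 ht.2 i)

variable [Fintype ι]

lemma measurableSet_cell {B : ι → Set (ℝ × ℝ)} (hB : ∀ i, MeasurableSet (B i)) (s : Finset ι) :
    MeasurableSet (cell B s) := by
  refine (MeasurableSet.iUnion hB).inter (MeasurableSet.iInter fun i => ?_)
  by_cases h : i ∈ s
  · simpa [h] using hB i
  · simp only [h, iff_false]
    exact (hB i).compl

/-- The intersection with $\bigcup_i B_i$ in `cell` matters for $s=\emptyset$, where a complement of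
infinite volume would otherwise arise. -/
lemma volume_cell_lt_top {B : ι → Set (ℝ × ℝ)} (hB : ∀ i, volume (B i) < ∞) (s : Finset ι) :
    volume (cell B s) < ∞ := by
  refine (measure_mono inter_subset_left).trans_lt ((measure_iUnion_le _).trans_lt ?_)
  rw [tsum_fintype]
  exact ENNReal.sum_lt_top.2 fun i _ => hB i

open Classical in
lemma measure_eq_sum_cell {B : ι → Set (ℝ × ℝ)} (hB : ∀ i, MeasurableSet (B i))
    (φ : Measure (ℝ × ℝ)) (i : ι) :
    φ (B i) = ∑ s with i ∈ s, φ (cell B s) := by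
  rw [← measure_biUnion_finset (fun s _ t _ hst => pairwise_disjoint_cell B hst)
    fun s _ => measurableSet_cell hB s]
  congr 1
  ext q
  simp only [Finset.mem_filter, Finset.mem_univ, true_and, mem_iUnion, exists_prop]
  constructor
  · intro hq
    exact ⟨Finset.univ.filter fun j => q ∈ B j, by simpa using hq, mem_iUnion.2 ⟨i, hq⟩,
      mem_iInter.2 fun j => by simp⟩
  · rintro ⟨s, his, hq⟩
    exact (mem_iInter.1 hq.2 i).2 his

variable {Ω Ω' : Type*} [MeasurableSpace Ω] [MeasurableSpace Ω']
  {μ : Measure Ω} {μ' : Measure Ω'} {γ : ℝ} {E : Set (ℝ × ℝ)} {Φ : Ω → Measure (ℝ × ℝ)} {Ψ : Ω' → Measure (ℝ × ℝ)}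

lemma IsPoissonProcess.measurable_apply (h : IsPoissonProcess μ γ E Φ) {B : Set (ℝ × ℝ)}
    (hB : MeasurableSet B) : Measurable fun ω => Φ ω B :=
  (Measure.measurable_coe hB).comp h.measurable

lemma IsPoissonSystem.measurable_odd {Φo : Fin 5 → Ω → Measure (ℝ × ℝ)}
    {Φe : Ω → Measure (ℝ × ℝ)} (h : IsPoissonSystem μ γ Φo Φe) :
    Measurable fun ω l => Φo l ω :=
  measurable_pi_lambda _ fun l => (h.odd l).measurable

/-- A measurable function of the processes which agrees with `GVariable`. -/
def GFun (γ : ℝ) (l : Fin 5) (r : (Fin 5 → Measure (ℝ × ℝ)) × Measure (ℝ × ℝ)) : ℝ :=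
  GMeas (r.1 l) (window ((l : ℕ) + 1 : ℝ) r.2) γ

lemma measurable_GFun (γ : ℝ) (l : Fin 5) : Measurable (GFun γ l) := by
  have h : Measurable fun r : (Fin 5 → Measure (ℝ × ℝ)) × Measure (ℝ × ℝ) =>
      (r.1 l, window ((l : ℕ) + 1 : ℝ) r.2) :=
    ((measurable_pi_apply l).comp measurable_fst).prodMk
      ((measurable_window _).comp measurable_snd)
  have h1 := (measurable_GMeas γ).comp h
  exact h1

/-- Agreement holds for every `ω`, because the realizations are point measures without exception. -/
lemma IsPoissonSystem.GVariable_eq {Φo : Fin 5 → Ω → Measure (ℝ × ℝ)}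
    {Φe : Ω → Measure (ℝ × ℝ)} (h : IsPoissonSystem μ γ Φo Φe) (l : Fin 5) :
    GVariable γ Φo Φe l = GFun γ l ∘ fun ω => ((fun l => Φo l ω), Φe ω) := by
  ext ω
  exact (GMeas_eq ((h.odd l).pointMeasure ω).annulusFinite ((h.even.pointMeasure ω).atomic.window _)
    ((h.even.pointMeasure ω).annulusFinite_window _) γ).symm

lemma IsPoissonSystem.measurable_GVariable {Φo : Fin 5 → Ω → Measure (ℝ × ℝ)}
    {Φe : Ω → Measure (ℝ × ℝ)} (h : IsPoissonSystem μ γ Φo Φe) (l : Fin 5) :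
    Measurable (GVariable γ Φo Φe l) := by
  rw [h.GVariable_eq l]
  exact (measurable_GFun γ l).comp (h.measurable_odd.prodMk h.even.measurable)

variable [IsProbabilityMeasure μ] [IsProbabilityMeasure μ']

lemma IsPoissonProcess.map_eq_pi (h : IsPoissonProcess μ γ E Φ) {A : ι → Set (ℝ × ℝ)}
    (hA : ∀ i, MeasurableSet (A i)) (hv : ∀ i, volume (A i) < ∞)
    (hd : Pairwise (Function.onFun Disjoint A)) :
    μ.map (fun ω i => Φ ω (A i)) = Measure.pi fun i =>
      (poissonMeasure (γ * (volume (A i ∩ E)).toReal).toNNReal).map (fun n : ℕ => (n : ℝ≥0∞)) := by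
  have e := Fintype.equivFin ι
  have h1 := (h.indep _ (fun j => A (e.symm j)) (fun j => hA _)
    fun i j hij => hd (e.symm.injective.ne hij)).precomp e.injective
  simp only [Equiv.symm_apply_apply] at h1
  rw [(iIndepFun_iff_map_fun_eq_pi_map fun i => (h.measurable_apply (hA i)).aemeasurable).1 h1]
  congr 1
  ext1 i
  exact h.law _ (hA i) ((measure_mono inter_subset_left).trans_lt (hv i))

/-- Overlapping sets are reduced to their disjoint cells, where the counts have a known product law;
the masses of the `B i` are a fixed measurable function of the cell counts. -/
lemma IsPoissonProcess.map_masses_eq (h : IsPoissonProcess μ γ E Φ)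
    (h' : IsPoissonProcess μ' γ E Ψ) {B : ι → Set (ℝ × ℝ)}
    (hB : ∀ i, MeasurableSet (B i)) (hv : ∀ i, volume (B i) < ∞) :
    μ.map (fun ω i => Φ ω (B i)) = μ'.map (fun ω i => Ψ ω (B i)) := by
  classical
  have hT : Measurable fun (f : Finset ι → ℝ≥0∞) (i : ι) => ∑ s with i ∈ s, f s :=
    measurable_pi_lambda _ fun i => Finset.measurable_sum _ fun s _ => measurable_pi_apply s
  have h1 := h.map_eq_pi (measurableSet_cell hB) (volume_cell_lt_top hv) (pairwise_disjoint_cell B)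
  rw [← h'.map_eq_pi (measurableSet_cell hB) (volume_cell_lt_top hv)
    (pairwise_disjoint_cell B)] at h1
  have h2 := congrArg (Measure.map fun (f : Finset ι → ℝ≥0∞) (i : ι) => ∑ s with i ∈ s, f s) h1
  rw [Measure.map_map hT (measurable_pi_lambda _ fun s =>
      h.measurable_apply (measurableSet_cell hB s)),
    Measure.map_map hT (measurable_pi_lambda _ fun s =>
      h'.measurable_apply (measurableSet_cell hB s))] at h2
  simpa only [Function.comp_def, ← measure_eq_sum_cell hB] using h2

/-- The law of a homogeneous Poisson process is determined by its intensity. -/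
theorem IsPoissonProcess.map_eq (h : IsPoissonProcess μ γ E Φ)
    (h' : IsPoissonProcess μ' γ E Ψ) : μ.map Φ = μ'.map Ψ := by
  have := Measure.isProbabilityMeasure_map (μ := μ) h.measurable.aemeasurable
  have := Measure.isProbabilityMeasure_map (μ := μ') h'.measurable.aemeasurable
  refine measure_ext_of_map_masses ?_
  -- Finite measures on a product space with equal finite-dimensional marginals coincide.
  refine IsProjectiveLimit.unique
    (P := fun I => ((μ'.map Ψ).map masses).map I.restrict) (fun I => ?_) fun I => rfl
  beta_reduce
  rw [Measure.map_map measurable_masses h.measurable,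
    Measure.map_map measurable_masses h'.measurable,
    Measure.map_map (Finset.measurable_restrict I) (measurable_masses.comp h.measurable),
    Measure.map_map (Finset.measurable_restrict I) (measurable_masses.comp h'.measurable)]
  exact h.map_masses_eq h' (B := fun i : I => i.1.1) (fun i => i.1.2.1) fun i => i.1.2.2

theorem IsPoissonSystem.map_eq {Φo : Fin 5 → Ω → Measure (ℝ × ℝ)} {Φe : Ω → Measure (ℝ × ℝ)}
    {Ψo : Fin 5 → Ω' → Measure (ℝ × ℝ)} {Ψe : Ω' → Measure (ℝ × ℝ)}
    (h : IsPoissonSystem μ γ Φo Φe) (h' : IsPoissonSystem μ' γ Ψo Ψe) :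
    μ.map (fun ω => ((fun l => Φo l ω), Φe ω)) = μ'.map (fun ω => ((fun l => Ψo l ω), Ψe ω)) := by
  rw [(indepFun_iff_map_prod_eq_prod_map_map h.measurable_odd.aemeasurable
      h.even.measurable.aemeasurable).1 h.indep_odd_even,
    (indepFun_iff_map_prod_eq_prod_map_map h'.measurable_odd.aemeasurable
      h'.even.measurable.aemeasurable).1 h'.indep_odd_even,
    (iIndepFun_iff_map_fun_eq_pi_map fun l => (h.odd l).measurable.aemeasurable).1 h.indep_odd,
    (iIndepFun_iff_map_fun_eq_pi_map fun l => (h'.odd l).measurable.aemeasurable).1 h'.indep_odd,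
    h.even.map_eq h'.even]
  simp_rw [fun l => (h.odd l).map_eq (h'.odd l)]

theorem IsPoissonSystem.varianceConstant_eq {Φo : Fin 5 → Ω → Measure (ℝ × ℝ)}
    {Φe : Ω → Measure (ℝ × ℝ)} {Ψo : Fin 5 → Ω' → Measure (ℝ × ℝ)} {Ψe : Ω' → Measure (ℝ × ℝ)}
    (h : IsPoissonSystem μ γ Φo Φe) (h' : IsPoissonSystem μ' γ Ψo Ψe) :
    varianceConstant μ γ Φo Φe = varianceConstant μ' γ Ψo Ψe := by
  refine Finset.sum_congr rfl fun l _ => ?_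
  rw [h.GVariable_eq, h.GVariable_eq, h'.GVariable_eq, h'.GVariable_eq,
    ← covariance_map (measurable_GFun γ _).aestronglyMeasurable
      (measurable_GFun γ _).aestronglyMeasurable
      (h.measurable_odd.prodMk h.even.measurable).aemeasurable,
    ← covariance_map (measurable_GFun γ _).aestronglyMeasurable
      (measurable_GFun γ _).aestronglyMeasurable
      (h'.measurable_odd.prodMk h'.even.measurable).aemeasurable, h.map_eq h']

end

/-! ### Square integrability at intensity one -/

section

/-- Four boxes of width `1/2` and depth `n`, next to each other above `[-1/2, 3/2]`. -/
def box (i : Fin 4) (n : ℕ) : Set (ℝ × ℝ) :=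
  Ioo ((i : ℝ) / 2 - 1 / 2) ((i : ℝ) / 2) ×ˢ Icc (-(n : ℝ)) 0

lemma measurableSet_box (i : Fin 4) (n : ℕ) : MeasurableSet (box i n) :=
  measurableSet_Ioo.prod measurableSet_Icc

/-- The part of `[0,1] × (-∞, 0]` of depth `n`. -/
def strip (n : ℕ) : Set (ℝ × ℝ) := Icc (0 : ℝ) 1 ×ˢ Icc (-(n : ℝ)) 0

lemma measurableSet_strip (n : ℕ) : MeasurableSet (strip n) :=
  measurableSet_Icc.prod measurableSet_Icc

/-- A nondecreasing line is at least as high at `x` as at the left point `q`; a nonincreasing one,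
at least as high as at the right point `r`. -/
lemma neg_le_of_line {x p₀ p₁ c : ℝ} {q r : ℝ × ℝ} (hq : q.2 ≤ p₀ + p₁ * (q.1 - x))
    (hr : r.2 ≤ p₀ + p₁ * (r.1 - x)) (hqc : c ≤ q.2) (hrc : c ≤ r.2) (hqx : q.1 ≤ x)
    (hrx : x ≤ r.1) : c ≤ p₀ := by
  rcases le_total 0 p₁ with h | h
  · nlinarith [mul_nonneg h (sub_nonneg.2 hqx)]
  · nlinarith [mul_nonneg (neg_nonneg.2 h) (sub_nonneg.2 hrx)]

lemma Atomic.exists_mem {φ : Measure (ℝ × ℝ)} (h : Atomic φ) {B : Set (ℝ × ℝ)}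
    (hB : MeasurableSet B) (h0 : φ B ≠ 0) : ∃ q ∈ B, 0 < φ {q} := by
  by_contra! hcon
  exact h0 (h B hB fun q hq => nonpos_iff_eq_zero.1 (hcon q hq))

lemma gTilde_mem_Icc {φ : Measure (ℝ × ℝ)} (h : Atomic φ)
    (hneg : ∀ q : ℝ × ℝ, 0 < φ {q} → q.2 ≤ 0) {n : ℕ} (hn : ∀ i, φ (box i n) ≠ 0) {x : ℝ}
    (hx : x ∈ Icc (0 : ℝ) 1) : gTilde φ x ∈ Icc (-(n : ℝ)) 0 := by
  have hlow : ∀ p₀ ∈ {p₀ : ℝ | ∃ p₁ : ℝ, ∀ q : ℝ × ℝ, 0 < φ {q} → |x - q.1| < 1 →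
      q.2 ≤ p₀ + p₁ * (q.1 - x)}, -(n : ℝ) ≤ p₀ := by
    rintro p₀ ⟨p₁, hp⟩
    choose q hq hqφ using fun i => h.exists_mem (measurableSet_box i n) (hn i)
    have h0 := hq 0
    have h1 := hq 1
    have h2 := hq 2
    have h3 := hq 3
    simp only [box, mem_prod, mem_Ioo, mem_Icc] at h0 h1 h2 h3
    norm_num at h0 h1 h2 h3
    -- The two boxes chosen lie on either side of `x` and within distance $1$ of it: boxes 0 and 2
    -- for $x\le 1/2$, boxes 1 and 3 otherwise.
    rcases le_total x (1 / 2) with hx2 | hx2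
    · exact neg_le_of_line
        (hp _ (hqφ 0) (abs_lt.2 ⟨by linarith [hx.1, hx.2], by linarith [hx.1, hx.2]⟩))
        (hp _ (hqφ 2) (abs_lt.2 ⟨by linarith [hx.1, hx.2], by linarith [hx.1, hx.2]⟩))
        (by linarith) (by linarith) (by linarith [hx.1]) (by linarith)
    · exact neg_le_of_line
        (hp _ (hqφ 1) (abs_lt.2 ⟨by linarith [hx.1, hx.2], by linarith [hx.1, hx.2]⟩))
        (hp _ (hqφ 3) (abs_lt.2 ⟨by linarith [hx.1, hx.2], by linarith [hx.1, hx.2]⟩))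
        (by linarith) (by linarith) (by linarith) (by linarith [hx.2])
  have h0 : (0 : ℝ) ∈ {p₀ : ℝ | ∃ p₁ : ℝ, ∀ q : ℝ × ℝ, 0 < φ {q} → |x - q.1| < 1 →
      q.2 ≤ p₀ + p₁ * (q.1 - x)} := ⟨0, fun q hq _ => by simpa using hneg q hq⟩
  exact ⟨le_csInf ⟨0, h0⟩ hlow, csInf_le ⟨_, hlow⟩ h0⟩

lemma enorm_G_le {φo φe : Measure (ℝ × ℝ)} (ho : φo (Icc (0 : ℝ) 1 ×ˢ Iic (0 : ℝ))ᶜ = 0)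
    {n : ℕ} (hn : ∀ x ∈ Icc (0 : ℝ) 1, gTilde φe x ∈ Icc (-(n : ℝ)) 0) :
    ‖G φo φe 1‖ₑ ≤ n ^ 2 * (1 + 2 * φo (strip n)) := by
  classical
  have h1 : ‖∫ x in (0 : ℝ)..1, gTilde φe x ^ 2‖ ≤ (n : ℝ) ^ 2 := by
    refine (intervalIntegral.norm_integral_le_of_norm_le_const (C := (n : ℝ) ^ 2)
      fun x hx => ?_).trans_eq (by simp)
    rw [uIoc_of_le zero_le_one] at hx
    have := hn x ⟨hx.1.le, hx.2⟩
    rw [Real.norm_of_nonneg (sq_nonneg _)]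
    exact sq_le_sq' this.1 (this.2.trans n.cast_nonneg)
  have h2 : ‖∫ q, (if gTilde φe q.1 ≤ q.2 then q.2 else 0) ∂φo‖ₑ ≤ n * φo (strip n) := by
    refine (enorm_integral_le_lintegral_enorm _).trans ?_
    rw [← lintegral_indicator_const (measurableSet_strip n)]
    refine lintegral_mono_ae ?_
    filter_upwards [compl_mem_ae_iff.2 ho] with q hq
    rw [compl_compl] at hq
    split_ifs with hg
    · have h3 := (hn q.1 hq.1).1.trans hg
      rw [indicator_of_mem (show q ∈ strip n from ⟨hq.1, h3, hq.2⟩),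
        ← ofReal_norm, Real.norm_of_nonpos hq.2, ← ENNReal.ofReal_natCast]
      exact ENNReal.ofReal_le_ofReal (by linarith)
    · simp
  have h3 : ‖∫ x in (0 : ℝ)..1, gTilde φe x ^ 2‖ₑ ≤ (n : ℝ≥0∞) ^ 2 := by
    rw [← ofReal_norm]
    refine (ENNReal.ofReal_le_ofReal h1).trans_eq ?_
    rw [ENNReal.ofReal_pow n.cast_nonneg, ENNReal.ofReal_natCast]
  have h4 : ‖(1 / 2 : ℝ)‖ₑ ≤ 1 := by
    rw [← ofReal_norm, ← ENNReal.ofReal_one]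
    exact ENNReal.ofReal_le_ofReal (by norm_num)
  have h5 : ‖(2 / 1 : ℝ)‖ₑ = 2 := by
    rw [← ofReal_norm]
    norm_num
  -- This lets both terms share the factor $n^2$.
  have h6 : (n : ℝ≥0∞) ≤ n ^ 2 := by exact_mod_cast Nat.le_self_pow two_ne_zero n
  calc ‖G φo φe 1‖ₑ ≤ 1 * n ^ 2 + 2 * (n * φo (strip n)) := by
        rw [G]
        refine (enorm_add_le _ _).trans ?_
        rw [enorm_mul, enorm_mul, h5]
        gcongr
    _ ≤ 1 * n ^ 2 + 2 * (n ^ 2 * φo (strip n)) := by gcongr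
    _ = n ^ 2 * (1 + 2 * φo (strip n)) := by ring

lemma lintegral_poissonMeasure (r : ℝ≥0) (f : ℕ → ℝ≥0∞) :
    ∫⁻ k, f k ∂(poissonMeasure r) =
      ∑' k, ENNReal.ofReal (Real.exp (-r) * r ^ k / k.factorial) * f k := by
  rw [poissonMeasure, lintegral_sum_measure]
  simp

/-- The square is dominated by a geometric sequence, whose Poisson mean is explicit. The ratio
$81/64=(9/8)^2$ is chosen so that the resulting rate $81/64-1=17/64$ stays below $1/2$. -/
lemma lintegral_sq_poissonMeasure_le (r : ℝ≥0) :
    ∫⁻ k : ℕ, (1 + 2 * (k : ℝ≥0∞)) ^ 2 ∂(poissonMeasure r) ≤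
      ENNReal.ofReal (256 * Real.exp (17 / 64 * r)) := by
  rw [lintegral_poissonMeasure]
  have hs : HasSum (fun k : ℕ => 256 * Real.exp (-r) * ((81 / 64 * r : ℝ) ^ k / k.factorial))
      (256 * Real.exp (17 / 64 * r)) := by
    have h := (NormedSpace.expSeries_div_hasSum_exp (81 / 64 * r : ℝ)).mul_left
      (256 * Real.exp (-r))
    rw [← Real.exp_eq_exp_ℝ, mul_assoc, ← Real.exp_add,
      show -(r : ℝ) + 81 / 64 * r = 17 / 64 * r by ring] at h
    exact h
  rw [← hs.tsum_eq, ENNReal.ofReal_tsum_of_nonneg (fun k => by positivity) hs.summable]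
  refine ENNReal.tsum_le_tsum fun k => ?_
  have h1 : (1 + 2 * (k : ℝ)) ^ 2 ≤ 256 * (81 / 64 : ℝ) ^ k := by
    -- Bernoulli gives $1+k/8\le(9/8)^k$, and $1+2k\le 16(1+k/8)$.
    have hb := one_add_mul_le_pow (show (-2 : ℝ) ≤ 1 / 8 by norm_num) k
    have hk : (0 : ℝ) ≤ k := k.cast_nonneg
    calc (1 + 2 * (k : ℝ)) ^ 2 ≤ (16 * (1 + 1 / 8 : ℝ) ^ k) ^ 2 :=
          pow_le_pow_left₀ (by positivity) (by linarith) 2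
      _ = 256 * (81 / 64 : ℝ) ^ k := by
          rw [mul_pow, ← pow_mul, mul_comm k 2, pow_mul]
          norm_num
  have h2 : (1 + 2 * (k : ℝ≥0∞)) ^ 2 = ENNReal.ofReal ((1 + 2 * (k : ℝ)) ^ 2) := by
    rw [ENNReal.ofReal_pow (by positivity), ENNReal.ofReal_add zero_le_one (by positivity),
      ENNReal.ofReal_mul zero_le_two]
    simp
  rw [h2, ← ENNReal.ofReal_mul (by positivity)]
  refine ENNReal.ofReal_le_ofReal ?_
  calc Real.exp (-r) * r ^ k / k.factorial * (1 + 2 * (k : ℝ)) ^ 2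
      ≤ Real.exp (-r) * r ^ k / k.factorial * (256 * (81 / 64 : ℝ) ^ k) := by gcongr
    _ = _ := by rw [mul_pow]; ring

variable {Ω : Type*} [MeasurableSpace Ω] {μ : Measure Ω} {E : Set (ℝ × ℝ)}
  {Φ : Ω → Measure (ℝ × ℝ)}

lemma IsPoissonProcess.measure_eq_zero (h : IsPoissonProcess μ 1 E Φ) {B : Set (ℝ × ℝ)}
    (hB : MeasurableSet B) {v : ℝ} (hv0 : 0 ≤ v) (hv : volume (B ∩ E) = ENNReal.ofReal v) :
    μ {ω | Φ ω B = 0} = ENNReal.ofReal (Real.exp (-v)) := by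
  have h1 := congrArg (fun m => m {0}) (h.law B hB (by rw [hv]; exact ENNReal.ofReal_lt_top))
  simp only [hv, ENNReal.toReal_ofReal hv0, one_mul] at h1
  rw [Measure.map_apply (h.measurable_apply hB) (measurableSet_singleton _),
    Measure.map_apply (by fun_prop) (measurableSet_singleton _)] at h1
  have h2 : (fun n : ℕ => (n : ℝ≥0∞)) ⁻¹' {0} = {0} := by ext; simp
  rw [h2, poissonMeasure_singleton] at h1
  simpa [hv0] using! h1

lemma IsPoissonProcess.lintegral_sq_le (h : IsPoissonProcess μ 1 E Φ) {B : Set (ℝ × ℝ)}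
    (hB : MeasurableSet B) {v : ℝ} (hv0 : 0 ≤ v) (hv : volume (B ∩ E) = ENNReal.ofReal v) :
    ∫⁻ ω, (1 + 2 * Φ ω B) ^ 2 ∂μ ≤ ENNReal.ofReal (256 * Real.exp (17 / 64 * v)) := by
  have h1 := h.law B hB (by rw [hv]; exact ENNReal.ofReal_lt_top)
  have h2 : Measurable fun x : ℝ≥0∞ => (1 + 2 * x) ^ 2 := by fun_prop
  rw [← lintegral_map h2 (h.measurable_apply hB), h1, lintegral_map h2 (by fun_prop), hv,
    ENNReal.toReal_ofReal hv0, one_mul]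
  refine (lintegral_sq_poissonMeasure_le _).trans_eq ?_
  rw [Real.coe_toNNReal _ hv0]

/-- The boxes lie over $[-1/2,3/2]\subset(-1,2]$, so the cut made by the window does not affect
them. -/
lemma window_box (k : ℝ) (φ : Measure (ℝ × ℝ)) (i : Fin 4) (n : ℕ) :
    window k φ (box i n) = φ (Ioo ((i : ℝ) / 2 - 1 / 2 + (k - 1)) ((i : ℝ) / 2 + (k - 1)) ×ˢ
      Icc (-(n : ℝ)) 0) := by
  rw [window_apply k φ (measurableSet_box i n)]
  congr 1
  have h3 : (i : ℝ) ≤ 3 := by exact_mod_cast Nat.le_of_lt_succ i.2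
  have h0 : (0 : ℝ) ≤ i := Nat.cast_nonneg _
  ext q
  simp only [box, mem_inter_iff, mem_preimage, mem_prod, mem_Ioo, mem_Icc, mem_Ioc, mem_univ,
    and_true]
  constructor
  · rintro ⟨⟨⟨h1, h2⟩, h⟩, -⟩
    exact ⟨⟨by linarith, by linarith⟩, h⟩
  · rintro ⟨⟨h1, h2⟩, h⟩
    exact ⟨⟨⟨by linarith, by linarith⟩, h⟩, by linarith, by linarith⟩

lemma IsPoissonProcess.measure_window_box_eq_zero
    (h : IsPoissonProcess μ 1 ((univ : Set ℝ) ×ˢ Iic (0 : ℝ)) Φ) (k : ℝ) (i : Fin 4) (n : ℕ) :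
    μ {ω | window k (Φ ω) (box i n) = 0} = ENNReal.ofReal (Real.exp (-(n / 2))) := by
  simp_rw [window_box]
  refine h.measure_eq_zero (measurableSet_Ioo.prod measurableSet_Icc) (by positivity) ?_
  rw [inter_eq_left.2 (prod_mono (subset_univ _) fun y hy => hy.2), Measure.volume_eq_prod,
    Measure.prod_prod, Real.volume_Ioo, Real.volume_Icc, ← ENNReal.ofReal_mul (by linarith)]
  congr 1
  ring

/-- The measures that have no mass in one of the boxes of depth `n`. -/
def emptyBox (k : ℝ) (n : ℕ) : Set (Measure (ℝ × ℝ)) := ⋃ i, {φ | window k φ (box i n) = 0}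

lemma measurableSet_emptyBox (k : ℝ) (n : ℕ) : MeasurableSet (emptyBox k n) :=
  MeasurableSet.iUnion fun i => measurableSet_eq_fun
    ((Measure.measurable_coe (measurableSet_box i n)).comp (measurable_window k)) measurable_const

lemma IsPoissonProcess.measure_emptyBox_le
    (h : IsPoissonProcess μ 1 ((univ : Set ℝ) ×ˢ Iic (0 : ℝ)) Φ) (k : ℝ) (n : ℕ) :
    μ (Φ ⁻¹' emptyBox k n) ≤ ENNReal.ofReal (4 * Real.exp (-(n / 2))) := by
  rw [emptyBox, preimage_iUnion]
  refine (measure_iUnion_le _).trans_eq ?_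
  rw [tsum_fintype, Finset.sum_congr rfl fun i _ => show
    μ (Φ ⁻¹' {φ | window k φ (box i n) = 0}) = _ from h.measure_window_box_eq_zero k i n, Finset.sum_const, Finset.card_univ, Fintype.card_fin, ENNReal.ofReal_mul (by norm_num),
    nsmul_eq_mul]
  simp

lemma IsPoissonProcess.lintegral_strip_le
    (h : IsPoissonProcess μ 1 (Icc (0 : ℝ) 1 ×ˢ Iic (0 : ℝ)) Φ) (n : ℕ) :
    ∫⁻ ω, (1 + 2 * Φ ω (strip n)) ^ 2 ∂μ ≤ ENNReal.ofReal (256 * Real.exp (17 / 64 * n)) := by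
  refine h.lintegral_sq_le (measurableSet_strip n) n.cast_nonneg ?_
  rw [strip, inter_eq_left.2 (prod_mono subset_rfl fun y hy => hy.2), Measure.volume_eq_prod,
    Measure.prod_prod, Real.volume_Icc, Real.volume_Icc]
  simp

/-- A bound for `|G|²` while `gTilde ≥ -n`. -/
def sqBound (n : ℕ) (φ : Measure (ℝ × ℝ)) : ℝ≥0∞ := n ^ 4 * (1 + 2 * φ (strip n)) ^ 2

lemma measurable_sqBound (n : ℕ) : Measurable (sqBound n) :=
  (((Measure.measurable_coe (measurableSet_strip n)).const_mul 2).const_add 1).pow_const 2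
    |>.const_mul _

lemma enorm_G_sq_le {φo φe : Measure (ℝ × ℝ)}
    (ho : IsPointMeasure (Icc (0 : ℝ) 1 ×ˢ Iic (0 : ℝ)) φo)
    (he : IsPointMeasure ((univ : Set ℝ) ×ˢ Iic (0 : ℝ)) φe) (k : ℝ) {n : ℕ}
    (hn : φe ∉ emptyBox k n) : ‖G φo (window k φe) 1‖ₑ ^ 2 ≤ sqBound n φo := by
  have hneg : ∀ q : ℝ × ℝ, 0 < window k φe {q} → q.2 ≤ 0 := by
    intro q hq
    by_contra! hlt
    refine hq.ne' ?_
    rw [window_apply k _ (measurableSet_singleton q)]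
    refine measure_mono_null ?_ (he.apply_compl (MeasurableSet.univ.prod measurableSet_Iic))
    rintro r ⟨rfl, -⟩
    simpa using hlt
  have h := enorm_G_le (ho.apply_compl (measurableSet_Icc.prod measurableSet_Iic))
    (φe := window k φe) (n := n) fun x hx => gTilde_mem_Icc (he.atomic.window k) hneg
      (fun i h0 => hn (mem_iUnion.2 ⟨i, h0⟩)) hx
  refine (pow_le_pow_left' h 2).trans_eq ?_
  rw [sqBound]
  ring

/-- Let $N$ be the first depth at which every box is hit. If $N=m+1$, some box is empty at depth
$m$, so the $m$-th term alone is the bound at depth $N$; if $N=0$, that bound is $0$. -/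
lemma enorm_G_sq_le_tsum {φo φe : Measure (ℝ × ℝ)}
    (ho : IsPointMeasure (Icc (0 : ℝ) 1 ×ˢ Iic (0 : ℝ)) φo)
    (he : IsPointMeasure ((univ : Set ℝ) ×ˢ Iic (0 : ℝ)) φe) (k : ℝ) :
    ‖G φo (window k φe) 1‖ₑ ^ 2 ≤
      ∑' n, (emptyBox k n).indicator 1 φe * sqBound (n + 1) φo := by
  classical
  by_cases hex : ∃ n, φe ∉ emptyBox k n
  · have hmin := fun m => Nat.find_min hex (m := m)
    have hle := enorm_G_sq_le ho he k (Nat.find_spec hex)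
    generalize Nat.find hex = N at hmin hle
    rcases N with - | m
    · exact hle.trans (by simp [sqBound])
    · refine (hle.trans_eq ?_).trans (ENNReal.le_tsum m)
      rw [indicator_of_mem (not_not.1 (hmin m m.lt_succ_self))]
      simp
  -- Without such a depth every term is at least $1$, so the sum is infinite.
  · push Not at hex
    refine le_top.trans_eq (top_unique ?_).symm
    rw [← ENNReal.tsum_const_eq_top_of_ne_zero (α := ℕ) one_ne_zero]
    refine ENNReal.tsum_le_tsum fun n => ?_
    rw [indicator_of_mem (hex n), Pi.one_apply, one_mul, sqBound]
    refine one_le_mul (one_le_pow₀ ?_) (one_le_pow₀ le_self_add)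
    exact_mod_cast Nat.le_add_left 1 n

/-- The exponents leave the decay rate $1/2-17/64=15/64$; the shift from $n$ to $n+1$ costs a factor
$e^{1/2}$. -/
lemma summable_sqBound : Summable fun n : ℕ => 4 * Real.exp (-((n : ℝ) / 2)) *
    (((n + 1 : ℕ) : ℝ) ^ 4 * (256 * Real.exp (17 / 64 * ((n + 1 : ℕ) : ℝ)))) := by
  have h := ((summable_nat_add_iff 1).2 (Real.summable_pow_mul_exp_neg_nat_mul 4
    (show (0 : ℝ) < 15 / 64 by norm_num))).mul_left (1024 * Real.exp (1 / 2))
  refine h.congr fun n => ?_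
  have h1 : Real.exp (-((n : ℝ) / 2)) * Real.exp (17 / 64 * ((n + 1 : ℕ) : ℝ)) =
      Real.exp (1 / 2) * Real.exp (-(15 / 64) * ((n + 1 : ℕ) : ℝ)) := by
    rw [← Real.exp_add, ← Real.exp_add]
    congr 1
    push_cast
    ring
  linear_combination (-1024 * ((n + 1 : ℕ) : ℝ) ^ 4) * h1

variable {Φo : Fin 5 → Ω → Measure (ℝ × ℝ)} {Φe : Ω → Measure (ℝ × ℝ)}

/-- The indicator depends on the even process and `sqBound` on an odd one, so independence factors
the expectation. -/
lemma IsPoissonSystem.lintegral_mul_sqBound_le (h : IsPoissonSystem μ 1 Φo Φe) (l : Fin 5)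
    (k : ℝ) (n : ℕ) :
    ∫⁻ ω, (emptyBox k n).indicator 1 (Φe ω) * sqBound (n + 1) (Φo l ω) ∂μ ≤
      ENNReal.ofReal (4 * Real.exp (-((n : ℝ) / 2)) *
        (((n + 1 : ℕ) : ℝ) ^ 4 * (256 * Real.exp (17 / 64 * ((n + 1 : ℕ) : ℝ))))) := by
  have hind : Measurable ((emptyBox k n).indicator (1 : Measure (ℝ × ℝ) → ℝ≥0∞)) :=
    measurable_one.indicator (measurableSet_emptyBox k n)
  have hi := h.indep_odd_even.symm.comp (ψ := fun f : Fin 5 → Measure (ℝ × ℝ) =>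
    sqBound (n + 1) (f l)) hind ((measurable_sqBound (n + 1)).comp (measurable_pi_apply l))
  have h1 := lintegral_mul_eq_lintegral_mul_lintegral_of_indepFun
    (hind.comp h.even.measurable) ((measurable_sqBound (n + 1)).comp (h.odd l).measurable) hi
  refine h1.trans_le ?_
  rw [ENNReal.ofReal_mul (by positivity)]
  gcongr
  · have h2 : (emptyBox k n).indicator (1 : Measure (ℝ × ℝ) → ℝ≥0∞) ∘ Φe =
        (Φe ⁻¹' emptyBox k n).indicator 1 := rfl
    rw [h2, lintegral_indicator_one (h.even.measurable (measurableSet_emptyBox k n))]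
    exact h.even.measure_emptyBox_le k n
  · simp only [Function.comp_def, sqBound]
    rw [lintegral_const_mul' _ _ (by finiteness), ENNReal.ofReal_mul (by positivity),
      ENNReal.ofReal_pow (by positivity), ENNReal.ofReal_natCast]
    gcongr
    exact (h.odd l).lintegral_strip_le (n + 1)

theorem IsPoissonSystem.memLp_GVariable (h : IsPoissonSystem μ 1 Φo Φe) (l : Fin 5) :
    MemLp (GVariable 1 Φo Φe l) 2 μ := by
  refine ⟨(h.measurable_GVariable l).aestronglyMeasurable, ?_⟩
  rw [eLpNorm_lt_top_iff_lintegral_rpow_enorm_lt_top two_ne_zero ENNReal.ofNat_ne_top]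
  simp only [ENNReal.toReal_ofNat, ENNReal.rpow_ofNat]
  have hle : ∫⁻ ω, ‖GVariable 1 Φo Φe l ω‖ₑ ^ 2 ∂μ ≤ ∑' n, ∫⁻ ω,
      (emptyBox ((l : ℕ) + 1 : ℝ) n).indicator 1 (Φe ω) * sqBound (n + 1) (Φo l ω) ∂μ := by
    have hm (n : ℕ) : Measurable fun ω =>
        (emptyBox ((l : ℕ) + 1 : ℝ) n).indicator 1 (Φe ω) * sqBound (n + 1) (Φo l ω) :=
      ((measurable_one.indicator (measurableSet_emptyBox _ n)).comp h.even.measurable).mul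
        ((measurable_sqBound (n + 1)).comp (h.odd l).measurable)
    rw [← lintegral_tsum fun n => (hm n).aemeasurable]
    exact lintegral_mono fun ω =>
      enorm_G_sq_le_tsum ((h.odd l).pointMeasure ω) (h.even.pointMeasure ω) _
  refine hle.trans_lt ((ENNReal.tsum_le_tsum fun n =>
    h.lintegral_mul_sqBound_le l _ n).trans_lt ?_)
  rw [← ENNReal.ofReal_tsum_of_nonneg (fun n => by positivity) summable_sqBound]
  exact ENNReal.ofReal_lt_top

end

end

end BoundaryRegression

theorem mainTheorem11 {Ω Ω' : Type*} [MeasurableSpace Ω] [MeasurableSpace Ω']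
    (μ : Measure Ω) [IsProbabilityMeasure μ] (μ' : Measure Ω') [IsProbabilityMeasure μ']
    (γ : ℝ) (hγ : 0 < γ)
    (Φo : Fin 5 → Ω → Measure (ℝ × ℝ)) (Φe : Ω → Measure (ℝ × ℝ))
    (hΦ : BoundaryRegression.IsPoissonSystem μ γ Φo Φe)
    (Ψo : Fin 5 → Ω' → Measure (ℝ × ℝ)) (Ψe : Ω' → Measure (ℝ × ℝ))
    (hΨ : BoundaryRegression.IsPoissonSystem μ' 1 Ψo Ψe) :
    (∀ l, MemLp (BoundaryRegression.GVariable γ Φo Φe l) 2 μ) ∧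
    BoundaryRegression.varianceConstant μ γ Φo Φe =
      BoundaryRegression.varianceConstant μ' 1 Ψo Ψe / γ ^ 4 := by
  have hS := hΦ.scaled hγ
  constructor
  · intro l
    rw [BoundaryRegression.GVariable_scaled hγ]
    exact (hS.memLp_GVariable l).const_mul _
  -- The given system of intensity $1$ may be replaced by the scaled one, which lives on the same
  -- space as the system of intensity $\gamma$.
  · rw [← hS.varianceConstant_eq hΨ]
    simp only [BoundaryRegression.varianceConstant, Finset.sum_div]
    refine Finset.sum_congr rfl fun l _ => ?_
    rw [BoundaryRegression.GVariable_scaled hγ Φo Φe 2,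
      BoundaryRegression.GVariable_scaled hγ Φo Φe l, covariance_const_mul_left,
      covariance_const_mul_right]
    field_simp
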